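/- Let $\xi_1,\xi_2,\dots$ be i.i.d. real random variables with $\mathbb{E}|\xi_1|<\infty$ and $$\lim_{u\to\infty}u^{-p}\log\mathbb{P}\{|\xi_1|\ge u\}=-c$$ for some constants $1\le p<\infty$ and $0<c<\infty$. Let $q\in(1,\infty]$ be given by $\frac1p+\frac1q=1$ (so $q=\infty$ if $p=1$), and let $(a_n)_{n\ge1}$ be a sequence of positive real numbers such that $\sum_{n=1}^\infty a_n^{\min(2,q)}<\infty$ and such that the random series $\sum_{n=1}^\infty a_n|\xi_n|$ converges almost surely. Put $\|a\|_q=\bigl(\sum_{n=1}^\infty a_n^q\bigr)^{1/q}$ if $q<\infty$ and $\|a\|_\infty=\max_n a_n$. Then, as $r\to\infty$, $$\log\mathbb{P}\Bigl\{\sum_{n=1}^\infty a_n|\xi_n|\ge r\Bigr\}\sim -c\,r^p\,\|a\|_q^{-p},$$ that is, the ratio of the two sides tends to $1$. -/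

import Mathlib

open MeasureTheory ProbabilityTheory Filter Topology
open scoped ENNReal Asymptotics

/-- The `ℓ^q` norm of a real sequence for `q ∈ [1, ∞]`: `(∑ |a_n|^q)^(1/q)` if `q < ∞`, and
`sup |a_n|` if `q = ∞` (a maximum whenever `a_n → 0`). -/
noncomputable def lqNorm (q : ℝ≥0∞) (a : ℕ → ℝ) : ℝ :=
  if q = ∞ then ⨆ n, |a n| else (∑' n, |a n| ^ q.toReal) ^ (1 / q.toReal)

/-! The cheapest way for the series to reach `r` is for finitely many variables to be jointly large,
`X n ≥ t n * r` with `∑ a n * t n ≥ 1`. By independence this costs about `c r^p ∑ (t n)^p`, and by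
Hölder duality the infimum of `∑ (t n)^p` is `‖a‖_q^(-p)`; near-optimal finite `t` give the lower
bound (`exists_one_le_sum_mul_and_sum_rpow_lt`, `prod_measureReal_ge_le_measureReal_tsum_mul_ge`).

For the upper bound, Hölder turns a large finite sum into a large `∑ (X n)^p`, and Chernoff applies
because `exp (b (X n)^p)` is integrable for every `b < c` (`measureReal_sum_mul_ge_le`). The
Chernoff factor grows with the number of terms, so the series is cut at a fixed index. Almost sure
convergence forces `∑ a n < ∞`, so the remainder has small total weight, and convexity alone bounds
its tail at a rate at least as good (`measureReal_tsum_mul_ge_le`). -/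

/-! ### Summability of the weights and exponential moments -/

/-- If the weighted series of nonnegative identically distributed variables converges almost surely
and the variables do not vanish almost surely, then the weights are summable. -/
theorem summable_of_ae_summable_mul_identDistrib {Ω : Type*} [MeasurableSpace Ω] {μ : Measure Ω}
    [IsProbabilityMeasure μ] {X : ℕ → Ω → ℝ} (hmeas : ∀ n, Measurable (X n))
    (hnonneg : ∀ n ω, 0 ≤ X n ω) (hident : ∀ n, IdentDistrib (X n) (X 0) μ μ)
    {u : ℝ} (hu : 0 < u) (hpos : 0 < μ.real {ω | u ≤ X 0 ω})
    {a : ℕ → ℝ} (ha : ∀ n, 0 ≤ a n) (hconv : ∀ᵐ ω ∂μ, Summable fun n => a n * X n ω) :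
    Summable a := by
  set δ := μ.real {ω | u ≤ X 0 ω} with hδ
  have hB : ∀ n, MeasurableSet {ω | u ≤ X n ω} := fun n => measurableSet_le measurable_const (hmeas n)
  have hBδ : ∀ n, μ.real {ω | u ≤ X n ω} = δ := fun n =>
    congrArg ENNReal.toReal ((hident n).measure_mem_eq (measurableSet_Ici (a := u)))
  let E : ℕ → Set Ω := fun K => {ω | ∀ N, ∑ n ∈ Finset.range N, a n * X n ω ≤ K}
  have hE : ∀ K, MeasurableSet (E K) := fun K => by
    have : E K = ⋂ N, {ω | ∑ n ∈ Finset.range N, a n * X n ω ≤ K} := by ext; simp [E]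
    rw [this]
    exact MeasurableSet.iInter fun N => measurableSet_le (by fun_prop) measurable_const
  have hmono : Monotone E := fun K K' h ω hω N => (hω N).trans (by exact_mod_cast h)
  have huniv : μ (⋃ K, E K) = 1 := by
    rw [prob_compl_eq_zero_iff (MeasurableSet.iUnion hE) |>.symm]
    refine mem_ae_iff.1 (?_ : (⋃ K, E K) ∈ ae μ)
    filter_upwards [hconv] with ω hω
    obtain ⟨K, hK⟩ := exists_nat_ge (∑' n, a n * X n ω)
    exact Set.mem_iUnion.2 ⟨K, fun N =>
      (hω.sum_le_tsum _ fun n _ => mul_nonneg (ha n) (hnonneg n ω)).trans hK⟩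
  -- `E K` is so likely that it meets each event `u ≤ X n`, of probability `δ`, in at least `δ / 2`.
  -- Integrating the partial sums over `E K` then bounds `∑ a n`, without independence.
  obtain ⟨K, hK⟩ : ∃ K, 1 - δ / 2 < μ.real (E K) := by
    have h := tendsto_measure_iUnion_atTop (μ := μ) hmono
    rw [huniv] at h
    have h' := (ENNReal.tendsto_toReal ENNReal.one_ne_top).comp h
    exact (h'.eventually_const_lt (by simpa using hpos)).exists
  have hBE : ∀ n, δ / 2 ≤ μ.real ({ω | u ≤ X n ω} ∩ E K) := fun n => by
    have h1 := measureReal_union_add_inter (μ := μ) (s := {ω | u ≤ X n ω}) (hE K)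
    have h2 : μ.real ({ω | u ≤ X n ω} ∪ E K) ≤ 1 := measureReal_le_one
    rw [hBδ] at h1
    linarith
  have hKu : 0 < u * (δ / 2) := by positivity
  refine summable_of_sum_range_le (c := K / (u * (δ / 2))) ha fun N => ?_
  rw [le_div_iff₀ hKu]
  have hBEm : ∀ n, MeasurableSet ({ω | u ≤ X n ω} ∩ E K) := fun n => (hB n).inter (hE K)
  calc (∑ n ∈ Finset.range N, a n) * (u * (δ / 2))
      = ∑ n ∈ Finset.range N, a n * u * (δ / 2) := by
        rw [Finset.sum_mul]; exact Finset.sum_congr rfl fun n _ => by ring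
    _ ≤ ∑ n ∈ Finset.range N, a n * u * μ.real ({ω | u ≤ X n ω} ∩ E K) :=
        Finset.sum_le_sum fun n _ => mul_le_mul_of_nonneg_left (hBE n) (mul_nonneg (ha n) hu.le)
    _ = ∫ ω, ∑ n ∈ Finset.range N,
          ({ω | u ≤ X n ω} ∩ E K).indicator (fun _ => a n * u) ω ∂μ := by
        rw [integral_finsetSum _ fun n _ => (integrable_const _).indicator (hBEm n)]
        refine Finset.sum_congr rfl fun n _ => ?_
        rw [integral_indicator_const _ (hBEm n), smul_eq_mul, mul_comm]
    _ ≤ ∫ _, (K : ℝ) ∂μ := by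
        refine integral_mono (integrable_finsetSum _ fun n _ =>
          (integrable_const _).indicator (hBEm n)) (integrable_const _) fun ω => ?_
        by_cases hω : ω ∈ E K
        · refine (Finset.sum_le_sum fun n _ => ?_).trans (hω N)
          by_cases h : u ≤ X n ω
          · rw [Set.indicator_of_mem (Set.mem_inter (by exact h) hω)]
            exact mul_le_mul_of_nonneg_left h (ha n)
          · rw [Set.indicator_of_notMem fun h' => h h'.1]
            exact mul_nonneg (ha n) (hnonneg n ω)
        · simp [hω]
    _ = K := by simp

/-- A variable whose tail is eventually at most `exp (-c z)` has exponential moments of every order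
below `c`. -/
theorem integrable_exp_mul_of_tail_le {Ω : Type*} [MeasurableSpace Ω] {μ : Measure Ω}
    [IsProbabilityMeasure μ] {Z : Ω → ℝ} (hZ : Measurable Z) (hnonneg : ∀ ω, 0 ≤ Z ω)
    {b c : ℝ} (hb : 0 ≤ b) (hbc : b < c)
    (htail : ∀ᶠ z : ℝ in atTop, μ.real {ω | z ≤ Z ω} ≤ Real.exp (-c * z)) :
    Integrable (fun ω => Real.exp (b * Z ω)) μ := by
  have hsum : Summable fun k : ℕ => Real.exp (b * (k + 1)) * μ.real {ω | (k : ℝ) ≤ Z ω} := by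
    have hgeom : Summable fun k : ℕ => Real.exp b * Real.exp (b - c) ^ k :=
      (summable_geometric_of_lt_one (Real.exp_pos _).le
        (Real.exp_lt_one_iff.2 (by linarith))).mul_left _
    refine hgeom.of_norm_bounded_eventually_nat ?_
    filter_upwards [tendsto_natCast_atTop_atTop.eventually htail] with k hk
    rw [Real.norm_of_nonneg (by positivity)]
    calc Real.exp (b * (k + 1)) * μ.real {ω | (k : ℝ) ≤ Z ω}
        ≤ Real.exp (b * (k + 1)) * Real.exp (-c * k) := by gcongr
      _ = Real.exp b * Real.exp (b - c) ^ k := by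
        rw [← Real.exp_nat_mul, ← Real.exp_add, ← Real.exp_add]; ring_nf
  have hm : ∀ k : ℕ, MeasurableSet {ω | (k : ℝ) ≤ Z ω} :=
    fun k => measurableSet_le measurable_const hZ
  refine ⟨by fun_prop, ?_⟩
  calc ∫⁻ ω, ‖Real.exp (b * Z ω)‖ₑ ∂μ
      ≤ ∫⁻ ω, ∑' k : ℕ, {ω | (k : ℝ) ≤ Z ω}.indicator
          (fun _ => ENNReal.ofReal (Real.exp (b * (k + 1)))) ω ∂μ := by
        refine lintegral_mono fun ω => ?_
        -- The single layer `k = ⌊Z ω⌋₊` already dominates.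
        refine le_trans ?_ (ENNReal.le_tsum ⌊Z ω⌋₊)
        rw [Set.indicator_of_mem (by exact Nat.floor_le (hnonneg ω)),
          Real.enorm_of_nonneg (Real.exp_pos _).le]
        gcongr
        exact (Nat.lt_floor_add_one _).le
    _ = ∑' k : ℕ, ENNReal.ofReal (Real.exp (b * (k + 1)) * μ.real {ω | (k : ℝ) ≤ Z ω}) := by
        rw [lintegral_tsum fun k => (measurable_const.indicator (hm k)).aemeasurable]
        refine tsum_congr fun k => ?_
        rw [lintegral_indicator_const (hm k), ENNReal.ofReal_mul (Real.exp_pos _).le,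
          ofReal_measureReal]
    _ < ∞ := hsum.tsum_ofReal_lt_top

/-! ### Remainder bound by convexity -/

/-- Tail bound for a weighted sum of (possibly dependent) identically distributed variables:
the sum of the weights scales the argument. -/
theorem measureReal_tsum_mul_ge_le {Ω : Type*} [MeasurableSpace Ω] {μ : Measure Ω}
    [IsProbabilityMeasure μ] {X : ℕ → Ω → ℝ}
    (hnonneg : ∀ n ω, 0 ≤ X n ω) (hident : ∀ n, IdentDistrib (X n) (X 0) μ μ)
    {p c : ℝ} (hp : 1 ≤ p) (hc : 0 ≤ c) (hint : Integrable (fun ω => Real.exp (c * X 0 ω ^ p)) μ)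
    {a : ℕ → ℝ} (ha : ∀ n, 0 < a n) (hsum : Summable a)
    (hconv : ∀ᵐ ω ∂μ, Summable fun n => a n * X n ω) {s t : ℝ} (ht : 0 ≤ t) (hts : t < s) :
    μ.real {ω | s ≤ ∑' n, a n * X n ω} ≤
      (∫ ω, Real.exp (c * X 0 ω ^ p) ∂μ) * Real.exp (-c * (t / ∑' n, a n) ^ p) := by
  set M := ∫ ω, Real.exp (c * X 0 ω ^ p) ∂μ with hM
  have hM0 : 0 ≤ M := integral_nonneg fun _ => (Real.exp_pos _).le
  set σ := ∑' n, a n with hσ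
  have hidexp : ∀ n, IdentDistrib (fun ω => Real.exp (c * X n ω ^ p))
      (fun ω => Real.exp (c * X 0 ω ^ p)) μ μ := fun n =>
    (hident n).comp (u := fun x => Real.exp (c * x ^ p)) (by fun_prop)
  have hpart : ∀ N, μ.real {ω | t < ∑ n ∈ Finset.range N, a n * X n ω} ≤
      M * Real.exp (-c * (t / σ) ^ p) := by
    intro N
    rcases Nat.eq_zero_or_pos N with rfl | hN
    · simp only [Finset.range_zero, Finset.sum_empty, not_lt.2 ht, Set.ofPred_false,
        measureReal_empty]
      positivity
    set A := ∑ n ∈ Finset.range N, a n with hA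
    have hA0 : 0 < A := Finset.sum_pos (fun n _ => ha n) (Finset.nonempty_range_iff.2 hN.ne')
    have hAσ : A ≤ σ := hsum.sum_le_tsum _ fun n _ => (ha n).le
    have hw : ∑ n ∈ Finset.range N, a n / A = 1 := by
      rw [← Finset.sum_div, ← hA, div_self hA0.ne']
    -- Power means, then Jensen for `exp`, give `exp (c * (weighted mean)^p) ≤ G`. By linearity `G`
    -- has mean `M` for every `N`, so Markov's bound is uniform in `N`.
    let G : Ω → ℝ := fun ω => ∑ n ∈ Finset.range N, a n / A * Real.exp (c * X n ω ^ p)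
    have hGint : ∀ n ∈ Finset.range N,
        Integrable (fun ω => a n / A * Real.exp (c * X n ω ^ p)) μ :=
      fun n _ => ((hidexp n).integrable_iff.2 hint).const_mul _
    have hG : ∫ ω, G ω ∂μ = M := by
      rw [integral_finsetSum _ hGint]
      simp_rw [integral_const_mul, fun n => (hidexp n).integral_eq]
      rw [← Finset.sum_mul, hw, one_mul]
    have hsub : {ω | t < ∑ n ∈ Finset.range N, a n * X n ω} ⊆
        {ω | Real.exp (c * (t / σ) ^ p) ≤ G ω} := by
      intro ω (hω : t < _)
      have h1 : t / σ ≤ ∑ n ∈ Finset.range N, a n / A * X n ω := by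
        calc t / σ ≤ t / A := by gcongr
          _ ≤ (∑ n ∈ Finset.range N, a n * X n ω) / A := by gcongr
          _ = _ := by
            rw [Finset.sum_div]; exact Finset.sum_congr rfl fun n _ => by ring
      calc Real.exp (c * (t / σ) ^ p)
          ≤ Real.exp (c * ∑ n ∈ Finset.range N, a n / A * X n ω ^ p) := by
            have hσ0 : 0 < σ := hA0.trans_le hAσ
            refine Real.exp_le_exp.2 (mul_le_mul_of_nonneg_left ?_ hc)
            refine (Real.rpow_le_rpow (by positivity) h1 (by linarith)).trans ?_
            exact Real.rpow_arith_mean_le_arith_mean_rpow _ _ _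
              (fun n _ => (div_pos (ha n) hA0).le) hw (fun n _ => hnonneg n ω) hp
        _ = Real.exp (∑ n ∈ Finset.range N, (a n / A) • (c * X n ω ^ p)) := by
            rw [Finset.mul_sum]
            congr 1
            exact Finset.sum_congr rfl fun n _ => by rw [smul_eq_mul]; ring
        _ ≤ G ω := convexOn_exp.map_sum_le (fun n _ => (div_pos (ha n) hA0).le) hw
            fun _ _ => Set.mem_univ _
    have hmarkov := mul_meas_ge_le_integral_of_nonneg (μ := μ) (f := G)
      (Eventually.of_forall fun ω => Finset.sum_nonneg fun n _ =>
        mul_nonneg (div_pos (ha n) hA0).le (Real.exp_pos _).le)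
      (integrable_finsetSum _ hGint) (Real.exp (c * (t / σ) ^ p))
    rw [hG] at hmarkov
    refine (measureReal_mono hsub).trans ?_
    rw [neg_mul, Real.exp_neg, ← div_eq_mul_inv, le_div_iff₀ (Real.exp_pos _), mul_comm]
    exact hmarkov
  have hunion : μ {ω | s ≤ ∑' n, a n * X n ω} ≤
      μ (⋃ N, {ω | t < ∑ n ∈ Finset.range N, a n * X n ω}) := by
    refine measure_mono_ae ?_
    filter_upwards [hconv] with ω hω (hs : s ≤ _)
    obtain ⟨N, hN⟩ := (hω.hasSum.tendsto_sum_nat.eventually_const_lt (hts.trans_le hs)).exists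
    exact Set.mem_iUnion.2 ⟨N, hN⟩
  have hmono : Monotone fun N => {ω | t < ∑ n ∈ Finset.range N, a n * X n ω} :=
    fun N N' h ω (hω : t < _) => hω.trans_le <|
      Finset.sum_le_sum_of_subset_of_nonneg (Finset.range_mono h) fun n _ _ =>
        mul_nonneg (ha n).le (hnonneg n ω)
  rw [hmono.measure_iUnion] at hunion
  refine ENNReal.toReal_le_of_le_ofReal (by positivity) (hunion.trans (iSup_le fun N => ?_))
  rw [← ofReal_measureReal]
  exact ENNReal.ofReal_le_ofReal (hpart N)

/-! ### Hölder duality for `lqNorm` -/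

/-- Conjugate exponents in the extended sense: either `p = 1` and `q = ∞`, or both are finite and
conjugate in the usual sense. -/
theorem ENNReal.ofReal_inv_add_inv_eq_one_cases {p : ℝ} (hp : 1 ≤ p) {q : ℝ≥0∞}
    (hpq : (ENNReal.ofReal p)⁻¹ + q⁻¹ = 1) :
    (p = 1 ∧ q = ∞) ∨ (q ≠ ∞ ∧ p.HolderConjugate q.toReal) := by
  have hp0 : 0 < p := by linarith
  have hq0 : q ≠ 0 := by rintro rfl; simp at hpq
  by_cases hq : q = ∞
  · subst hq
    simp only [ENNReal.inv_top, add_zero, ENNReal.inv_eq_one, ENNReal.ofReal_eq_one] at hpq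
    exact Or.inl ⟨hpq, rfl⟩
  · refine Or.inr ⟨hq, ?_⟩
    have hqpos : 0 < q.toReal := ENNReal.toReal_pos hq0 hq
    have h := congrArg ENNReal.toReal hpq
    rw [ENNReal.toReal_add (by simpa using hp0) (by simpa using hq0), ENNReal.toReal_inv,
      ENNReal.toReal_inv, ENNReal.toReal_ofReal hp0.le, ENNReal.toReal_one] at h
    refine Real.holderConjugate_iff.2 ⟨lt_of_le_of_ne hp ?_, h⟩
    rintro rfl
    have : 0 < q.toReal⁻¹ := inv_pos.2 hqpos
    simp at h
    linarith

theorem summable_rpow_of_summable {a : ℕ → ℝ} (ha : ∀ n, 0 ≤ a n) (hsum : Summable a) {q : ℝ}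
    (hq : 1 ≤ q) : Summable fun n => a n ^ q := by
  refine hsum.of_norm_bounded_eventually_nat ?_
  filter_upwards [hsum.tendsto_atTop_zero.eventually_le_const one_pos] with n hn
  rw [Real.norm_of_nonneg (Real.rpow_nonneg (ha n) q)]
  exact (Real.rpow_le_rpow_of_exponent_ge' (ha n) hn zero_le_one hq).trans (Real.rpow_one _).le

/-- A real `⨆` over an unbounded family defaults to `0`, so `le_ciSup` needs this bound when `q =
∞`. -/
theorem bddAbove_range_abs_of_summable {a : ℕ → ℝ} (hsum : Summable a) :
    BddAbove (Set.range fun n => |a n|) :=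
  hsum.tendsto_atTop_zero.abs.bddAbove_range

theorem lqNorm_pos {a : ℕ → ℝ} (ha : ∀ n, 0 < a n) (hsum : Summable a) {p : ℝ} (hp : 1 ≤ p)
    {q : ℝ≥0∞} (hpq : (ENNReal.ofReal p)⁻¹ + q⁻¹ = 1) : 0 < lqNorm q a := by
  rcases ENNReal.ofReal_inv_add_inv_eq_one_cases hp hpq with ⟨rfl, rfl⟩ | ⟨hq, hconj⟩
  · rw [lqNorm, if_pos rfl]
    exact (abs_pos.2 (ha 0).ne').trans_le (le_ciSup (bddAbove_range_abs_of_summable hsum) 0)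
  · rw [lqNorm, if_neg hq]
    simp_rw [fun n => abs_of_pos (ha n)]
    exact Real.rpow_pos_of_pos ((summable_rpow_of_summable (fun n => (ha n).le) hsum
      hconj.symm.lt.le).tsum_pos (fun n => Real.rpow_nonneg (ha n).le _) 0
        (Real.rpow_pos_of_pos (ha 0) _)) _

/-- Hölder's inequality for finite sums against `lqNorm`. -/
theorem sum_mul_rpow_le_lqNorm_rpow_mul {a : ℕ → ℝ} (ha : ∀ n, 0 < a n) (hsum : Summable a)
    {p : ℝ} (hp : 1 ≤ p) {q : ℝ≥0∞} (hpq : (ENNReal.ofReal p)⁻¹ + q⁻¹ = 1) (s : Finset ℕ)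
    {x : ℕ → ℝ} (hx : ∀ n, 0 ≤ x n) :
    (∑ n ∈ s, a n * x n) ^ p ≤ lqNorm q a ^ p * ∑ n ∈ s, x n ^ p := by
  rcases ENNReal.ofReal_inv_add_inv_eq_one_cases hp hpq with ⟨rfl, rfl⟩ | ⟨hq, hconj⟩
  · rw [lqNorm, if_pos rfl]
    simp only [Real.rpow_one, Finset.mul_sum]
    exact Finset.sum_le_sum fun n _ => mul_le_mul_of_nonneg_right
      ((le_abs_self _).trans (le_ciSup (bddAbove_range_abs_of_summable hsum) n)) (hx n)
  · have hx' : 0 ≤ ∑ n ∈ s, x n ^ p := Finset.sum_nonneg fun n _ => Real.rpow_nonneg (hx n) p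
    have hL := lqNorm_pos ha hsum hp hpq
    have h : ∑ n ∈ s, a n * x n ≤ lqNorm q a * (∑ n ∈ s, x n ^ p) ^ (1 / p) := by
      refine (Real.inner_le_Lp_mul_Lq s a x hconj.symm).trans ?_
      simp_rw [fun n => abs_of_nonneg (hx n)]
      refine mul_le_mul_of_nonneg_right ?_ (Real.rpow_nonneg hx' _)
      rw [lqNorm, if_neg hq]
      refine Real.rpow_le_rpow (Finset.sum_nonneg fun n _ => Real.rpow_nonneg (abs_nonneg _) _) ?_
        (one_div_nonneg.2 hconj.symm.nonneg)
      refine Summable.sum_le_tsum _ (fun n _ => Real.rpow_nonneg (abs_nonneg _) _) ?_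
      simp_rw [fun n => abs_of_pos (ha n)]
      exact summable_rpow_of_summable (fun n => (ha n).le) hsum hconj.symm.lt.le
    refine (Real.rpow_le_rpow (Finset.sum_nonneg fun n _ => mul_nonneg (ha n).le (hx n)) h
      (by linarith)).trans ?_
    rw [Real.mul_rpow hL.le (Real.rpow_nonneg hx' _), ← Real.rpow_mul hx', one_div,
      inv_mul_cancel₀ (by linarith), Real.rpow_one]

/-- Hölder's inequality is sharp up to `ε`, with finitely supported positive vectors. -/
theorem exists_one_le_sum_mul_and_sum_rpow_lt {a : ℕ → ℝ} (ha : ∀ n, 0 < a n) (hsum : Summable a)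
    {p : ℝ} (hp : 1 ≤ p) {q : ℝ≥0∞} (hpq : (ENNReal.ofReal p)⁻¹ + q⁻¹ = 1) {b : ℝ}
    (hb : lqNorm q a ^ (-p) < b) :
    ∃ (s : Finset ℕ) (t : ℕ → ℝ), (∀ n, 0 < t n) ∧ 1 ≤ ∑ n ∈ s, a n * t n ∧
      ∑ n ∈ s, t n ^ p < b := by
  have hL := lqNorm_pos ha hsum hp hpq
  rcases ENNReal.ofReal_inv_add_inv_eq_one_cases hp hpq with ⟨rfl, rfl⟩ | ⟨hq, hconj⟩
  · have hb0 : 0 < b := (Real.rpow_pos_of_pos hL _).trans hb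
    rw [Real.rpow_neg_one] at hb
    have hb' := inv_lt_of_inv_lt₀ hL hb
    rw [lqNorm, if_pos rfl] at hb'
    obtain ⟨n, hn⟩ := exists_lt_of_lt_ciSup hb'
    rw [abs_of_pos (ha n)] at hn
    refine ⟨{n}, fun n => (a n)⁻¹, fun n => inv_pos.2 (ha n), ?_, ?_⟩
    · simp [(ha n).ne']
    · simpa using inv_lt_of_inv_lt₀ hb0 hn
  · set Q := q.toReal with hQ
    have hQ1 : 1 < Q := hconj.symm.lt
    have hs := summable_rpow_of_summable (fun n => (ha n).le) hsum hQ1.le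
    set A := ∑' n, a n ^ Q with hA
    have hA0 : 0 < A := hs.tsum_pos (fun n => Real.rpow_nonneg (ha n).le _) 0
        (Real.rpow_pos_of_pos (ha 0) _)
    have hLA : lqNorm q a ^ (-p) = A ^ (1 - p) := by
      rw [lqNorm, if_neg hq]
      simp_rw [fun n => abs_of_pos (ha n)]
      rw [← Real.rpow_mul hA0.le]
      congr 1
      have := hconj.sub_one_mul_conj
      have hQ0 : Q ≠ 0 := by positivity
      change 1 / Q * -p = 1 - p
      rw [one_div, inv_mul_eq_div, div_eq_iff hQ0]
      linarith
    rw [hLA] at hb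
    have hlim : Tendsto (fun N => (∑ n ∈ Finset.range N, a n ^ Q) ^ (1 - p)) atTop
        (𝓝 (A ^ (1 - p))) :=
      hs.hasSum.tendsto_sum_nat.rpow_const (Or.inl hA0.ne')
    obtain ⟨N, hN, hN1⟩ := ((hlim.eventually_lt_const hb).and (eventually_ge_atTop 1)).exists
    set B := ∑ n ∈ Finset.range N, a n ^ Q with hB
    have hB0 : 0 < B := Finset.sum_pos (fun n _ => Real.rpow_pos_of_pos (ha n) _)
      (Finset.nonempty_range_iff.2 (by omega))
    -- The equality case of Hölder for the truncated weights, scaled so that `∑ a n * t n = 1`.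
    -- Since `(Q - 1) * p = Q`, its cost is `B ^ (1 - p)`.
    refine ⟨Finset.range N, fun n => a n ^ (Q - 1) / B,
      fun n => div_pos (Real.rpow_pos_of_pos (ha n) _) hB0, ?_, ?_⟩
    · refine le_of_eq ?_
      rw [eq_comm]
      calc ∑ n ∈ Finset.range N, a n * (a n ^ (Q - 1) / B)
          = ∑ n ∈ Finset.range N, a n ^ Q / B := Finset.sum_congr rfl fun n _ => by
            rw [Real.rpow_sub_one (ha n).ne', ← mul_div_assoc, mul_div_cancel₀ _ (ha n).ne']
        _ = 1 := by rw [← Finset.sum_div, ← hB, div_self hB0.ne']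
    · refine lt_of_eq_of_lt ?_ hN
      calc ∑ n ∈ Finset.range N, (a n ^ (Q - 1) / B) ^ p
          = ∑ n ∈ Finset.range N, a n ^ Q / B ^ p := Finset.sum_congr rfl fun n _ => by
            rw [Real.div_rpow (Real.rpow_nonneg (ha n).le _) hB0.le, ← Real.rpow_mul (ha n).le,
              hconj.symm.sub_one_mul_conj]
        _ = B ^ (1 - p) := by rw [← Finset.sum_div, ← hB, Real.rpow_sub hB0, Real.rpow_one]

/-! ### Upper bound for the series -/

/-- Chernoff's bound for a finite weighted sum of independent identically distributed variables. -/
theorem measureReal_sum_mul_ge_le {Ω : Type*} [MeasurableSpace Ω] {μ : Measure Ω}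
    [IsProbabilityMeasure μ] {X : ℕ → Ω → ℝ} (hmeas : ∀ n, Measurable (X n))
    (hnonneg : ∀ n ω, 0 ≤ X n ω) (hindep : iIndepFun X μ)
    (hident : ∀ n, IdentDistrib (X n) (X 0) μ μ)
    {p c : ℝ} (hp : 1 ≤ p) (hc : 0 ≤ c) (hint : Integrable (fun ω => Real.exp (c * X 0 ω ^ p)) μ)
    {q : ℝ≥0∞} (hpq : (ENNReal.ofReal p)⁻¹ + q⁻¹ = 1)
    {a : ℕ → ℝ} (ha : ∀ n, 0 < a n) (hsum : Summable a) (s : Finset ℕ) {r : ℝ} (hr : 0 ≤ r) :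
    μ.real {ω | r ≤ ∑ n ∈ s, a n * X n ω} ≤
      (∫ ω, Real.exp (c * X 0 ω ^ p) ∂μ) ^ s.card * Real.exp (-c * (r / lqNorm q a) ^ p) := by
  have hL := lqNorm_pos ha hsum hp hpq
  let Z : ℕ → Ω → ℝ := fun n ω => X n ω ^ p
  have hZm : ∀ n, Measurable (Z n) := fun n => (hmeas n).pow_const p
  have hZi : iIndepFun Z μ := hindep.comp (fun _ x => x ^ p) fun _ => by fun_prop
  have hidexp : ∀ n, IdentDistrib (fun ω => Real.exp (c * Z n ω))
      (fun ω => Real.exp (c * X 0 ω ^ p)) μ μ := fun n =>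
    (hident n).comp (u := fun x => Real.exp (c * x ^ p)) (by fun_prop)
  have hmgf : mgf (∑ n ∈ s, Z n) μ c = (∫ ω, Real.exp (c * X 0 ω ^ p) ∂μ) ^ s.card := by
    rw [hZi.mgf_sum hZm, ← Finset.prod_const]
    exact Finset.prod_congr rfl fun n _ => (hidexp n).integral_eq
  have hchernoff := measure_ge_le_exp_mul_mgf (μ := μ) ((r / lqNorm q a) ^ p) hc
    (hZi.integrable_exp_mul_sum hZm (s := s) fun n _ => (hidexp n).integrable_iff.2 hint)
  rw [hmgf, mul_comm] at hchernoff
  refine (measureReal_mono ?_).trans hchernoff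
  intro ω (hω : r ≤ _)
  have hLp := Real.rpow_pos_of_pos hL p
  simp only [Set.mem_ofPred_eq, Finset.sum_apply, Z]
  rw [Real.div_rpow hr hL.le, div_le_iff₀' hLp]
  exact (Real.rpow_le_rpow hr hω (by linarith)).trans
    (sum_mul_rpow_le_lqNorm_rpow_mul ha hsum hp hpq s fun n => hnonneg n ω)

/-- Exponential upper bound for the tail of a weighted series of independent identically
distributed variables. -/
theorem exists_measureReal_tsum_mul_ge_le {Ω : Type*} [MeasurableSpace Ω] {μ : Measure Ω}
    [IsProbabilityMeasure μ] {X : ℕ → Ω → ℝ} (hmeas : ∀ n, Measurable (X n))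
    (hnonneg : ∀ n ω, 0 ≤ X n ω) (hindep : iIndepFun X μ)
    (hident : ∀ n, IdentDistrib (X n) (X 0) μ μ)
    {p c : ℝ} (hp : 1 ≤ p) (hc : 0 ≤ c) (hint : Integrable (fun ω => Real.exp (c * X 0 ω ^ p)) μ)
    {q : ℝ≥0∞} (hpq : (ENNReal.ofReal p)⁻¹ + q⁻¹ = 1)
    {a : ℕ → ℝ} (ha : ∀ n, 0 < a n) (hsum : Summable a)
    (hconv : ∀ᵐ ω ∂μ, Summable fun n => a n * X n ω) {θ : ℝ} (hθ0 : 0 < θ) (hθ1 : θ < 1) :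
    ∃ K : ℝ, ∀ r : ℝ, 0 < r → μ.real {ω | r ≤ ∑' n, a n * X n ω} ≤
      K * Real.exp (-c * (θ * r / lqNorm q a) ^ p) := by
  have hL := lqNorm_pos ha hsum hp hpq
  set L := lqNorm q a
  set M := ∫ ω, Real.exp (c * X 0 ω ^ p) ∂μ
  have hM0 : 0 ≤ M := integral_nonneg fun _ => (Real.exp_pos _).le
  -- The head gets `θ * r` and the remainder `(1 - θ) * r`. Halving leaves the strict gap `t < s`
  -- required by the remainder bound, and `σ < η * L` makes its rate beat that of the head.
  set η := (1 - θ) / 2 with hη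
  have hη0 : 0 < η := by rw [hη]; linarith
  obtain ⟨N, hN⟩ := ((tendsto_sum_nat_add a).eventually_lt_const (by positivity : 0 < η * L)).exists
  have hsumN : Summable fun n => a (n + N) := (summable_nat_add_iff N).2 hsum
  set σ := ∑' n, a (n + N)
  have hσ0 : 0 < σ := hsumN.tsum_pos (fun n => (ha _).le) 0 (ha _)
  have hident' : ∀ n, IdentDistrib (X (n + N)) (X (0 + N)) μ μ := fun n =>
    (hident _).trans (hident _).symm
  have hidexp : IdentDistrib (fun ω => Real.exp (c * X (0 + N) ω ^ p))
      (fun ω => Real.exp (c * X 0 ω ^ p)) μ μ :=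
    (hident _).comp (u := fun x => Real.exp (c * x ^ p)) (by fun_prop)
  have hconv' : ∀ᵐ ω ∂μ, Summable fun n => a (n + N) * X (n + N) ω := by
    filter_upwards [hconv] with ω hω using (summable_nat_add_iff N).2 hω
  refine ⟨M ^ N + M, fun r hr => ?_⟩
  have hhead := measureReal_sum_mul_ge_le hmeas hnonneg hindep hident hp hc hint hpq ha hsum
    (Finset.range N) (by positivity : 0 ≤ θ * r)
  rw [Finset.card_range] at hhead
  have htail := measureReal_tsum_mul_ge_le (X := fun n => X (n + N)) (a := fun n => a (n + N))
    (fun n ω => hnonneg _ ω) hident' hp hc (hidexp.integrable_iff.2 hint)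
    (fun n => ha _) hsumN hconv' (s := (1 - θ) * r) (t := η * r) (by positivity)
    (by rw [hη]; nlinarith)
  rw [hidexp.integral_eq] at htail
  have htail' : Real.exp (-c * (η * r / σ) ^ p) ≤ Real.exp (-c * (θ * r / L) ^ p) := by
    refine Real.exp_le_exp.2 (mul_le_mul_of_nonpos_left ?_ (by linarith))
    refine Real.rpow_le_rpow (by positivity) ?_ (by linarith)
    rw [div_le_div_iff₀ hL hσ0]
    calc θ * r * σ ≤ 1 * r * (η * L) := by gcongr
      _ = η * r * L := by ring
  have hsplit : μ.real {ω | r ≤ ∑' n, a n * X n ω} ≤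
      μ.real {ω | θ * r ≤ ∑ n ∈ Finset.range N, a n * X n ω} +
        μ.real {ω | (1 - θ) * r ≤ ∑' n, a (n + N) * X (n + N) ω} := by
    refine le_trans ?_ (measureReal_union_le _ _)
    refine ENNReal.toReal_mono (measure_ne_top _ _) (measure_mono_ae ?_)
    filter_upwards [hconv] with ω hω (hr' : r ≤ _)
    rw [← hω.sum_add_tsum_nat_add N] at hr'
    by_contra h
    have h1 : ∑ n ∈ Finset.range N, a n * X n ω < θ * r := not_le.1 fun h' => h (Or.inl h')
    have h2 : ∑' n, a (n + N) * X (n + N) ω < (1 - θ) * r := not_le.1 fun h' => h (Or.inr h')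
    linarith
  calc _ ≤ _ := hsplit
    _ ≤ M ^ N * Real.exp (-c * (θ * r / L) ^ p) + M * Real.exp (-c * (θ * r / L) ^ p) :=
      add_le_add hhead (htail.trans (mul_le_mul_of_nonneg_left htail' hM0))
    _ = _ := by ring

/-! ### Lower bound and logarithmic limit -/

/-- Lower bound for the tail of a weighted series by the probability that finitely many variables
are simultaneously large. -/
theorem prod_measureReal_ge_le_measureReal_tsum_mul_ge {Ω : Type*} [MeasurableSpace Ω]
    {μ : Measure Ω} [IsProbabilityMeasure μ] {X : ℕ → Ω → ℝ}
    (hnonneg : ∀ n ω, 0 ≤ X n ω) (hindep : iIndepFun X μ)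
    (hident : ∀ n, IdentDistrib (X n) (X 0) μ μ) {a : ℕ → ℝ} (ha : ∀ n, 0 ≤ a n)
    (hconv : ∀ᵐ ω ∂μ, Summable fun n => a n * X n ω) {s : Finset ℕ} {t : ℕ → ℝ}
    (hst : 1 ≤ ∑ n ∈ s, a n * t n) {r : ℝ} (hr : 0 ≤ r) :
    ∏ n ∈ s, μ.real {ω | t n * r ≤ X 0 ω} ≤ μ.real {ω | r ≤ ∑' n, a n * X n ω} := by
  have hprod : ∏ n ∈ s, μ.real {ω | t n * r ≤ X 0 ω} =
      μ.real (⋂ n ∈ s, X n ⁻¹' Set.Ici (t n * r)) := by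
    rw [measureReal_def, hindep.measure_inter_preimage_eq_mul s fun n _ => measurableSet_Ici,
      ENNReal.toReal_prod]
    exact Finset.prod_congr rfl fun n _ =>
      congrArg ENNReal.toReal ((hident n).measure_mem_eq measurableSet_Ici).symm
  rw [hprod]
  refine ENNReal.toReal_mono (measure_ne_top _ _) (measure_mono_ae ?_)
  filter_upwards [hconv] with ω hω hmem
  have hmem' : ∀ n ∈ s, t n * r ≤ X n ω := fun n hn => Set.mem_iInter₂.1 hmem n hn
  calc r ≤ (∑ n ∈ s, a n * t n) * r := le_mul_of_one_le_left hr hst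
    _ = ∑ n ∈ s, a n * (t n * r) := by
      rw [Finset.sum_mul]; exact Finset.sum_congr rfl fun n _ => by ring
    _ ≤ ∑ n ∈ s, a n * X n ω :=
      Finset.sum_le_sum fun n hn => mul_le_mul_of_nonneg_left (hmem' n hn) (ha n)
    _ ≤ ∑' n, a n * X n ω := hω.sum_le_tsum _ fun n _ => mul_nonneg (ha n) (hnonneg n ω)

/-- Since `Real.log 0 = 0`, a null tail would give the value `0`, while the limit is negative. -/
theorem eventually_measureReal_ge_pos {Ω : Type*} [MeasurableSpace Ω] {μ : Measure Ω}
    {Y : Ω → ℝ} {p c : ℝ} (hc : 0 < c)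
    (htail : Tendsto (fun u : ℝ => u ^ (-p) * Real.log (μ.real {ω | u ≤ Y ω})) atTop (𝓝 (-c))) :
    ∀ᶠ u : ℝ in atTop, 0 < μ.real {ω | u ≤ Y ω} := by
  filter_upwards [htail.eventually_lt_const (neg_lt_zero.2 hc)] with u hu
  refine lt_of_le_of_ne measureReal_nonneg fun h => ?_
  rw [← h, Real.log_zero, mul_zero] at hu
  exact lt_irrefl _ hu

/-- The logarithmic tail asymptotics of a weighted series of nonnegative independent identically
distributed variables, as a limit. -/
theorem tendsto_rpow_mul_log_measureReal_tsum_mul_ge {Ω : Type*} [MeasurableSpace Ω]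
    {μ : Measure Ω} [IsProbabilityMeasure μ] {X : ℕ → Ω → ℝ} (hmeas : ∀ n, Measurable (X n))
    (hnonneg : ∀ n ω, 0 ≤ X n ω) (hindep : iIndepFun X μ)
    (hident : ∀ n, IdentDistrib (X n) (X 0) μ μ)
    {p c : ℝ} (hp : 1 ≤ p) (hc : 0 < c)
    (htail : Tendsto (fun u : ℝ => u ^ (-p) * Real.log (μ.real {ω | u ≤ X 0 ω})) atTop (𝓝 (-c)))
    {q : ℝ≥0∞} (hpq : (ENNReal.ofReal p)⁻¹ + q⁻¹ = 1)
    {a : ℕ → ℝ} (ha : ∀ n, 0 < a n) (hconv : ∀ᵐ ω ∂μ, Summable fun n => a n * X n ω) :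
    Tendsto (fun r : ℝ => r ^ (-p) * Real.log (μ.real {ω | r ≤ ∑' n, a n * X n ω})) atTop
      (𝓝 (-(c * lqNorm q a ^ (-p)))) := by
  have hp0 : 0 < p := by linarith
  have hpos := eventually_measureReal_ge_pos hc htail
  have hsum : Summable a := by
    obtain ⟨u, hu, hu0⟩ := (hpos.and (eventually_gt_atTop 0)).exists
    exact summable_of_ae_summable_mul_identDistrib hmeas hnonneg hident hu0 hu
      (fun n => (ha n).le) hconv
  have hexp : ∀ b, 0 ≤ b → b < c → Integrable (fun ω => Real.exp (b * X 0 ω ^ p)) μ := by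
    intro b hb hbc
    obtain ⟨d, hbd, hdc⟩ := exists_between hbc
    refine integrable_exp_mul_of_tail_le (c := d) ((hmeas 0).pow_const p)
      (fun ω => Real.rpow_nonneg (hnonneg 0 ω) p) hb hbd ?_
    have hroot : Tendsto (fun z : ℝ => z ^ (1 / p)) atTop atTop :=
      tendsto_rpow_atTop (by positivity)
    filter_upwards [hroot.eventually (htail.eventually_lt_const (neg_lt_neg hdc)),
      eventually_gt_atTop 0] with z hz hz0
    have hzp : (z ^ (1 / p)) ^ (-p) = z⁻¹ := by
      rw [← Real.rpow_mul hz0.le, ← Real.rpow_neg_one]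
      congr 1
      field_simp
    rw [hzp, inv_mul_eq_div, div_lt_iff₀ hz0] at hz
    have hset : {ω | z ≤ X 0 ω ^ p} = {ω | z ^ (1 / p) ≤ X 0 ω} := by
      ext ω
      simp only [Set.mem_ofPred_eq, one_div]
      exact (Real.rpow_inv_le_iff_of_pos hz0.le (hnonneg 0 ω) hp0).symm
    rw [hset]
    -- `x ≤ exp (log x)` also covers a tail of probability zero.
    exact (Real.le_exp_log _).trans (Real.exp_le_exp.2 hz.le)
  have hL := lqNorm_pos ha hsum hp hpq
  set L := lqNorm q a
  have hLp : 0 < L ^ (-p) := Real.rpow_pos_of_pos hL _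
  have hposS : ∀ᶠ r : ℝ in atTop, 0 < μ.real {ω | r ≤ ∑' n, a n * X n ω} := by
    have h0 : Tendsto (fun r : ℝ => (a 0)⁻¹ * r) atTop atTop :=
      tendsto_id.const_mul_atTop (inv_pos.2 (ha 0))
    filter_upwards [h0.eventually hpos, eventually_ge_atTop 0] with r hr hr0
    have h := prod_measureReal_ge_le_measureReal_tsum_mul_ge hnonneg hindep hident
      (fun n => (ha n).le) hconv (s := {0}) (t := fun n => (a n)⁻¹) (by simp [(ha 0).ne']) hr0
    rw [Finset.prod_singleton] at h
    exact hr.trans_le h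
  refine tendsto_order.2 ⟨fun y hy => ?_, fun y hy => ?_⟩
  -- The cost bound `b = -y / c` is chosen so that `∑ (t n)^p < b` means `-c * ∑ (t n)^p > y`.
  · have hb : L ^ (-p) < -y / c := by rw [lt_div_iff₀ hc]; linarith
    obtain ⟨s, t, ht, hst, htb⟩ := exists_one_le_sum_mul_and_sum_rpow_lt ha hsum hp hpq hb
    rw [lt_div_iff₀ hc] at htb
    have hlim : Tendsto (fun r : ℝ => ∑ n ∈ s, t n ^ p *
        ((t n * r) ^ (-p) * Real.log (μ.real {ω | t n * r ≤ X 0 ω}))) atTop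
        (𝓝 (∑ n ∈ s, t n ^ p * -c)) :=
      tendsto_finsetSum _ fun n _ =>
        (htail.comp (tendsto_id.const_mul_atTop (ht n))).const_mul _
    have hy' : y < ∑ n ∈ s, t n ^ p * -c := by rw [← Finset.sum_mul]; linarith
    have hposs : ∀ᶠ r : ℝ in atTop, ∀ n ∈ s, 0 < μ.real {ω | t n * r ≤ X 0 ω} :=
      (Finset.eventually_all s).2 fun n _ =>
        (tendsto_id.const_mul_atTop (ht n)).eventually hpos
    filter_upwards [hlim.eventually_const_lt hy', hposs,
      eventually_gt_atTop 0] with r hr hrs hr0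
    refine hr.trans_le ?_
    have hlog := Real.log_le_log (Finset.prod_pos hrs)
      (prod_measureReal_ge_le_measureReal_tsum_mul_ge hnonneg hindep hident
        (fun n => (ha n).le) hconv hst hr0.le)
    rw [Real.log_prod fun n hn => (hrs n hn).ne'] at hlog
    refine le_trans (le_of_eq ?_)
      (mul_le_mul_of_nonneg_left hlog (Real.rpow_nonneg hr0.le (-p)))
    rw [Finset.mul_sum]
    refine Finset.sum_congr rfl fun n _ => ?_
    rw [Real.mul_rpow (ht n).le hr0.le, ← mul_assoc, ← mul_assoc, ← Real.rpow_add (ht n),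
      add_neg_cancel, Real.rpow_zero, one_mul]
  -- `θ` acts twice: it lowers `c` to `θ * c` for integrability, and gives the head its share of
  -- `r`. Both losses vanish as `θ → 1`, while `r ^ (-p) * log K → 0` for fixed `θ`.
  · have hlimθ : Tendsto (fun θ : ℝ => -(θ * c * θ ^ p * L ^ (-p))) (𝓝[<] 1)
        (𝓝 (-(c * L ^ (-p)))) := by
      have : ContinuousAt (fun θ : ℝ => -(θ * c * θ ^ p * L ^ (-p))) 1 :=
        (((continuousAt_id.mul_const c).mul
          (Real.continuousAt_rpow_const 1 p (Or.inl one_ne_zero))).mul_const _).neg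
      have h := this.tendsto.mono_left (nhdsWithin_le_nhds (s := Set.Iio 1))
      simpa using h
    obtain ⟨θ, hθy, hθ1, hθ0⟩ := ((hlimθ.eventually_lt_const hy).and
      ((eventually_mem_nhdsWithin (a := (1 : ℝ)) (s := Set.Iio 1)).and
        ((eventually_gt_nhds (zero_lt_one (α := ℝ))).filter_mono nhdsWithin_le_nhds))).exists
    have hθ1 : θ < 1 := hθ1
    have hbc : θ * c < c := by nlinarith
    obtain ⟨K, hK⟩ := exists_measureReal_tsum_mul_ge_le hmeas hnonneg hindep hident hp
      (by positivity) (hexp (θ * c) (by positivity) hbc) hpq ha hsum hconv hθ0 hθ1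
    have hlim : Tendsto (fun r : ℝ => r ^ (-p) * Real.log K - θ * c * θ ^ p * L ^ (-p)) atTop
        (𝓝 (-(θ * c * θ ^ p * L ^ (-p)))) := by
      simpa using ((tendsto_rpow_neg_atTop hp0).mul_const (Real.log K)).sub_const
        (θ * c * θ ^ p * L ^ (-p))
    filter_upwards [hlim.eventually_lt_const hθy, hposS, eventually_gt_atTop 0] with r hr hrS hr0
    refine lt_of_le_of_lt ?_ hr
    have hKr := hK r hr0
    have hK0 : 0 < K := pos_of_mul_pos_left (hrS.trans_le hKr) (Real.exp_pos _).le
    have hlog := Real.log_le_log hrS hKr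
    rw [Real.log_mul hK0.ne' (Real.exp_pos _).ne', Real.log_exp] at hlog
    refine (mul_le_mul_of_nonneg_left hlog (Real.rpow_nonneg hr0.le (-p))).trans (le_of_eq ?_)
    have hrp : r ^ (-p) * r ^ p = 1 := by
      rw [← Real.rpow_add hr0, neg_add_cancel, Real.rpow_zero]
    rw [Real.div_rpow (by positivity) hL.le, Real.mul_rpow hθ0.le hr0.le, Real.rpow_neg hL.le,
      div_eq_mul_inv]
    linear_combination (-(θ * c * θ ^ p * (L ^ p)⁻¹)) * hrp

theorem theorem3p1 {Ω : Type*} [MeasurableSpace Ω] (μ : Measure Ω) [IsProbabilityMeasure μ]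
    (ξ : ℕ → Ω → ℝ) (hmeas : ∀ n, Measurable (ξ n)) (hindep : iIndepFun ξ μ)
    (hident : ∀ n, IdentDistrib (ξ n) (ξ 0) μ μ) (hint : Integrable (fun ω => |ξ 0 ω|) μ)
    (p c : ℝ) (hp : 1 ≤ p) (hc : 0 < c)
    (htail : Tendsto (fun u : ℝ => u ^ (-p) * Real.log (μ.real {ω | u ≤ |ξ 0 ω|}))
      atTop (𝓝 (-c)))
    (q : ℝ≥0∞) (hpq : (ENNReal.ofReal p)⁻¹ + q⁻¹ = 1)
    (a : ℕ → ℝ) (ha : ∀ n, 0 < a n) (hsum : Summable fun n => a n ^ (min 2 q).toReal)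
    (hconv : ∀ᵐ ω ∂μ, Summable fun n => a n * |ξ n ω|) :
    (fun r : ℝ => Real.log (μ.real {ω | r ≤ ∑' n, a n * |ξ n ω|}))
      ~[atTop] (fun r : ℝ => -(r ^ p * c * lqNorm q a ^ (-p))) := by
  have hlim := tendsto_rpow_mul_log_measureReal_tsum_mul_ge (X := fun n ω => |ξ n ω|)
    (fun n => (hmeas n).abs) (fun n ω => abs_nonneg _)
    (hindep.comp (fun _ x => |x|) fun _ => measurable_id.abs)
    (fun n => (hident n).comp measurable_id.abs) hp hc htail hpq ha hconv
  have hsummable : Summable a := by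
    obtain ⟨u, hu, hu0⟩ :=
      ((eventually_measureReal_ge_pos hc htail).and (eventually_gt_atTop 0)).exists
    exact summable_of_ae_summable_mul_identDistrib (fun n => (hmeas n).abs)
      (fun n ω => abs_nonneg _) (fun n => (hident n).comp measurable_id.abs) hu0 hu
      (fun n => (ha n).le) hconv
  -- A nonzero limit turns convergence into equivalence with a constant, which is then multiplied by
  -- `r ^ p`.
  have hne : -(c * lqNorm q a ^ (-p)) ≠ 0 :=
    (neg_neg_of_pos (mul_pos hc
      (Real.rpow_pos_of_pos (lqNorm_pos ha hsummable hp hpq) _))).ne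
  have hmul := (Asymptotics.IsEquivalent.refl (u := fun r : ℝ => r ^ p) (l := atTop)).mul
    ((Asymptotics.isEquivalent_const_iff_tendsto hne).2 hlim)
  refine (hmul.congr_left ?_).congr_right ?_
  · filter_upwards [eventually_gt_atTop 0] with r hr
    rw [Pi.mul_apply, ← mul_assoc, ← Real.rpow_add hr, add_neg_cancel, Real.rpow_zero, one_mul]
  · refine Eventually.of_forall fun r => ?_
    simp only [Pi.mul_apply, Function.const_apply]
    ring
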